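/- Let $\mathrm{Hilb}_r$ be the category whose objects are the complex Hilbert spaces and whose morphisms are the (not necessarily surjective) linear isometries. A category is called \emph{finitely concrete} if it admits a faithful functor to $\mathbf{Set}$ that preserves directed colimits. Then: 1. No faithful functor $U:\mathrm{Hilb}_r\to\mathbf{Set}$ preserves directed colimits; that is, $\mathrm{Hilb}_r$ is not finitely concrete. 2. $\mathrm{Hilb}_r$ is not equivalent to an abstract elementary class (AEC), that is, to the category whose objects are the members of an AEC $\mathbf{K}$ (in a set-sized finitary vocabulary) and whose morphisms are the $\mathbf{K}$-embeddings, i.e. the embeddings $f:M\to N$ of structures with $f[M]\leq_{\mathbf{K}} N$. 3. $\mathrm{Hilb}_r$ is not elementary: there is no (finitary, one-sorted) first-order theory $T$ such that $\mathrm{Hilb}_r$ is equivalent to the category $\mathbf{Mod}(T)$ of models of $T$ and all homomorphisms between them. -/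

import Mathlib

open CategoryTheory CategoryTheory.Limits FirstOrder

universe u v

/-! ### Complex Hilbert spaces with linear isometries -/

/-- The objects of `Hilb_r`: complex Hilbert spaces. -/
structure HilbR : Type (u + 1) where
  carrier : Type u
  [normedAddCommGroup : NormedAddCommGroup carrier]
  [innerProductSpace : InnerProductSpace ℂ carrier]
  [completeSpace : CompleteSpace carrier]

attribute [instance] HilbR.normedAddCommGroup HilbR.innerProductSpace HilbR.completeSpace

/-- The morphisms of `Hilb_r` are the (not necessarily surjective) linear isometries. -/
instance : Category.{u} HilbR.{u} where
  Hom A B := A.carrier →ₗᵢ[ℂ] B.carrier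
  id _ := LinearIsometry.id
  comp f g := g.comp f

/-! ### Finitely concrete categories -/

/-- `F` preserves directed colimits: for every nonempty directed poset `J` (of the size of a set)
and every diagram `J ⥤ C`, the functor `F` sends colimit cocones to colimit cocones. -/
def PreservesDirectedColimits {C : Type*} [Category* C] {D : Type*} [Category* D]
    (F : C ⥤ D) : Prop :=
  ∀ (J : Type u) [PartialOrder J] [IsDirectedOrder J] [Nonempty J], PreservesColimitsOfShape J F

/-- A category is finitely concrete if it admits a faithful functor to sets which preserves
directed colimits. -/
def FinitelyConcrete (C : Type*) [Category* C] : Prop :=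
  ∃ U : C ⥤ Type u, U.Faithful ∧ PreservesDirectedColimits.{u} U

/-! ### Elementary categories -/

/-- The objects of `Mod(T)`: the models of the first-order theory `T`. The empty structure is not
excluded by definition; adding to `T` the sentence which says that there is an element excludes
it. -/
structure ModelCat {L : FirstOrder.Language.{u, u}} (T : L.Theory) : Type (u + 1) where
  carrier : Type u
  [str : L.Structure carrier]
  models : carrier ⊨ T

attribute [instance] ModelCat.str

/-- The morphisms of `Mod(T)` are all homomorphisms of structures. -/
instance {L : FirstOrder.Language.{u, u}} (T : L.Theory) : Category.{u} (ModelCat T) where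
  Hom M N := M.carrier →[L] N.carrier
  id M := FirstOrder.Language.Hom.id L M.carrier
  comp f g := g.comp f

/-- A category is elementary if it is equivalent to `Mod(T)` for a first-order theory `T`. -/
def IsElementaryCategory (C : Type (u + 1)) [Category.{v} C] : Prop :=
  ∃ (L : FirstOrder.Language.{u, u}) (T : L.Theory), Nonempty (C ≌ ModelCat T)

/-! ### Abstract elementary classes -/

/-- `S` as a substructure of the structure `T`; meaningful when `S ≤ T`. -/
def FirstOrder.Language.Substructure.within {L : FirstOrder.Language.{u, u}} {N : Type u}
    [L.Structure N] (S T : L.Substructure N) : L.Substructure T :=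
  S.comap T.subtype.toHom

/-- An abstract elementary class in the finitary language `L`: a class `Mem` of `L`-structures,
with a relation `M ≤_K N`, which is here written `Strong M` for a substructure `M` of `N`. -/
structure AbstractElementaryClass (L : FirstOrder.Language.{u, u}) where
  /-- `N` belongs to the class `K`. -/
  Mem : ∀ (N : Type u) [L.Structure N], Prop
  /-- The substructure `M` of `N` satisfies `M ≤_K N`. -/
  Strong : ∀ {N : Type u} [L.Structure N], L.Substructure N → Prop
  /-- `≤_K` relates only members of the class. -/
  mem_of_strong : ∀ {N : Type u} [L.Structure N] {M : L.Substructure N},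
    Strong M → Mem M ∧ Mem N
  /-- The class is closed under isomorphism. -/
  mem_iso : ∀ {N N' : Type u} [L.Structure N] [L.Structure N'], (N ≃[L] N') → Mem N → Mem N'
  /-- The relation `≤_K` is closed under isomorphism. -/
  strong_iso : ∀ {N N' : Type u} [L.Structure N] [L.Structure N'] (e : N ≃[L] N')
    {M : L.Substructure N}, Strong M → Strong (M.map e.toHom)
  /-- Reflexivity of `≤_K`. -/
  refl : ∀ {N : Type u} [L.Structure N], Mem N → Strong (⊤ : L.Substructure N)
  /-- Transitivity: if `M ≤_K M'` and `M' ≤_K N`, then `M ≤_K N`. -/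
  trans : ∀ {N : Type u} [L.Structure N] {M M' : L.Substructure N},
    M ≤ M' → Strong (M.within M') → Strong M' → Strong M
  /-- Coherence: if `M ≤_K N`, `M' ≤_K N` and `M ⊆ M'`, then `M ≤_K M'`. -/
  coherence : ∀ {N : Type u} [L.Structure N] {M M' : L.Substructure N},
    M ≤ M' → Strong M → Strong M' → Strong (M.within M')
  /-- Chains: if the structure `N` is the union of a well-ordered chain which increases with
  respect to `≤_K`, then `N` is in `K`, and every member of the chain is `≤_K N`. -/
  chain_union : ∀ {ι : Type u} [LinearOrder ι] [WellFoundedLT ι] [Nonempty ι]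
    {N : Type u} [L.Structure N] (M : ι → L.Substructure N), Monotone M →
    (∀ i j, i ≤ j → Strong ((M i).within (M j))) → (∀ x : N, ∃ i, x ∈ M i) →
    Mem N ∧ ∀ i, Strong (M i)
  /-- Smoothness: if all members of a well-ordered chain which increases with respect to `≤_K`
  are `≤_K N`, then so is their union. -/
  chain_smooth : ∀ {ι : Type u} [LinearOrder ι] [WellFoundedLT ι] [Nonempty ι]
    {N : Type u} [L.Structure N] (M : ι → L.Substructure N), Monotone M →
    (∀ i j, i ≤ j → Strong ((M i).within (M j))) → (∀ i, Strong (M i)) →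
    Strong (⨆ i, M i)
  /-- The Löwenheim–Skolem–Tarski axiom. -/
  lowenheim_skolem : ∃ κ : Cardinal.{u}, Cardinal.aleph0 ≤ κ ∧ L.card ≤ κ ∧
    ∀ {N : Type u} [L.Structure N], Mem N → ∀ A : Set N,
      ∃ M : L.Substructure N, A ⊆ M ∧ Strong M ∧ Cardinal.mk M ≤ Cardinal.mk A + κ

namespace AbstractElementaryClass

variable {L : FirstOrder.Language.{u, u}} (K : AbstractElementaryClass L)

/-- `f` is a `K`-embedding: an embedding of structures whose image is `≤_K` its codomain. -/
def IsStrongEmbedding {M N : Type u} [L.Structure M] [L.Structure N] (f : M ↪[L] N) : Prop :=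
  K.Strong f.toHom.range

theorem isStrongEmbedding_id {M : Type u} [L.Structure M] (hM : K.Mem M) :
    K.IsStrongEmbedding (FirstOrder.Language.Embedding.refl L M) := by
  have h : (FirstOrder.Language.Embedding.refl L M).toHom.range = ⊤ := by
    ext x
    simp
  unfold IsStrongEmbedding
  rw [h]
  exact K.refl hM

theorem isStrongEmbedding_comp {M N P : Type u} [L.Structure M] [L.Structure N] [L.Structure P]
    {g : N ↪[L] P} {f : M ↪[L] N} (hg : K.IsStrongEmbedding g) (hf : K.IsStrongEmbedding f) :
    K.IsStrongEmbedding (g.comp f) := by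
  unfold IsStrongEmbedding at *
  have hle : (g.comp f).toHom.range ≤ g.toHom.range := by
    rintro _ ⟨x, rfl⟩
    exact ⟨f x, rfl⟩
  refine K.trans hle ?_ hg
  have h : (g.comp f).toHom.range.within g.toHom.range
      = f.toHom.range.map g.equivRange.toHom := by
    ext ⟨y, hy⟩
    constructor
    · rintro ⟨x, hx⟩
      exact ⟨f x, ⟨x, rfl⟩, Subtype.ext hx⟩
    · rintro ⟨_, ⟨x, rfl⟩, hx⟩
      exact ⟨x, congrArg Subtype.val hx⟩
  rw [h]
  exact K.strong_iso _ hf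

/-- The members of the class `K`, as objects of a category. -/
structure Obj : Type (u + 1) where
  carrier : Type u
  [str : L.Structure carrier]
  mem : K.Mem carrier

attribute [instance] Obj.str

/-- The category of an abstract elementary class: its morphisms are the `K`-embeddings. -/
instance : Category.{u} K.Obj where
  Hom M N := {f : M.carrier ↪[L] N.carrier // K.IsStrongEmbedding f}
  id M := ⟨Language.Embedding.refl L M.carrier, K.isStrongEmbedding_id M.mem⟩
  comp f g := ⟨g.1.comp f.1, K.isStrongEmbedding_comp g.2 f.2⟩

end AbstractElementaryClass

/-- A category is equivalent to an abstract elementary class (in some language). -/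
def IsEquivalentToAEC (C : Type (u + 1)) [Category.{v} C] : Prop :=
  ∃ (L : FirstOrder.Language.{u, u}) (K : AbstractElementaryClass L), Nonempty (C ≌ K.Obj)

/-! All the claims rest on one obstruction, `HilbR.exists_forall_map_ne`: `ℓ²` is the colimit in
`Hilb_r` of the spans of its first basis vectors, yet for a faithful functor `U` to sets, the images
of their values never cover `U ℓ²`. Suppose they did. Take a unit vector `v` whose coordinates from
index 1 on are suitable small sines, and let `f` be the inclusion of the line of `v`. For `x` in the
value of `U` at the line, `U f x` comes from some initial span. It is then fixed by the reflection
in the line of `v`, and also by the reflection in the hyperplane orthogonal to the next basis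
vector, since this hyperplane contains the span. The product `R` of the two reflections rotates a
plane through `v` by an angle `π / N`, so `R ^ N` sends `v` to `-v` and still fixes `U f x`. Thus
`U` does not distinguish `f` from `-f`, against faithfulness.

Conversely, colimits that are preserved in sets are covered by the diagram. The same holds in an AEC
for colimits of well-ordered chains, by smoothness and coherence, and in `Mod(T)` for directed
colimits of nonempty models, by an ultraproduct argument. The forgetful functors are faithful and
equivalences preserve colimits, so each case contradicts the obstruction. -/

/-! ### The standard infinite-dimensional separable Hilbert space -/

/-- The Hilbert space `ℓ²`, as an object of the given universe. -/
noncomputable abbrev EllTwo : Type u := lp (fun _ : ULift.{u} ℕ => ℂ) 2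

namespace EllTwo

/-- The standard orthonormal basis of `ℓ²`. -/
noncomputable def basisVec (k : ℕ) : EllTwo.{u} := lp.single 2 (ULift.up k) (1 : ℂ)

theorem inner_basisVec_left (k : ℕ) (x : EllTwo.{u}) :
    inner ℂ (basisVec k) x = x (ULift.up k) := by
  rw [basisVec, lp.inner_single_left]
  simp

theorem basisVec_apply (k l : ℕ) :
    (basisVec.{u} k : ∀ _ : ULift.{u} ℕ, ℂ) (ULift.up l) = if l = k then 1 else 0 := by
  rw [basisVec, lp.single_apply]
  by_cases h : l = k
  · subst h; simp
  · simp [h]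

theorem orthonormal_basisVec : Orthonormal ℂ basisVec.{u} := by
  rw [orthonormal_iff_ite]
  intro i j
  rw [inner_basisVec_left, basisVec_apply]

/-- The span of the first `n + 1` standard basis vectors. -/
noncomputable def initialSpan (n : ℕ) : Submodule ℂ EllTwo.{u} :=
  Submodule.span ℂ (basisVec '' Set.Iic n)

theorem initialSpan_mono : Monotone initialSpan.{u} := fun _ _ h =>
  Submodule.span_mono (Set.image_mono (Set.Iic_subset_Iic.2 h))

theorem basisVec_mem_initialSpan {k n : ℕ} (h : k ≤ n) : basisVec.{u} k ∈ initialSpan n :=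
  Submodule.subset_span ⟨k, h, rfl⟩

instance (n : ℕ) : FiniteDimensional ℂ (initialSpan.{u} n) :=
  FiniteDimensional.span_of_finite ℂ ((Set.finite_Iic n).image _)

/-- Continuity carries the agreement on basis vectors over to the convergent expansion of `x`. -/
theorem linearIsometry_ext {E : Type*} [NormedAddCommGroup E] [InnerProductSpace ℂ E]
    {f g : EllTwo.{u} →ₗᵢ[ℂ] E} (h : ∀ k, f (basisVec k) = g (basisVec k)) : f = g := by
  ext x
  have hx := lp.hasSum_single (E := fun _ : ULift.{u} ℕ => ℂ) (p := 2) (by norm_num) x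
  have key : ∀ i, f (lp.single 2 i (x i)) = g (lp.single 2 i (x i)) := by
    rintro ⟨k⟩
    have : (lp.single 2 (ULift.up k) (x (ULift.up k)) : EllTwo.{u})
        = x (ULift.up k) • basisVec k := by
      rw [basisVec, ← lp.single_smul]; simp
    rw [this, map_smul, map_smul, h]
  have hf := hx.map f.toLinearMap.toAddMonoidHom f.continuous
  have hg := hx.map g.toLinearMap.toAddMonoidHom g.continuous
  refine hf.unique ?_
  convert hg using 1
  · exact funext key
  · rfl

theorem exists_linearIsometry {E : Type*} [NormedAddCommGroup E] [InnerProductSpace ℂ E]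
    [CompleteSpace E] {b : ℕ → E} (hb : Orthonormal ℂ b) :
    ∃ f : EllTwo.{u} →ₗᵢ[ℂ] E, ∀ k, f (basisVec k) = b k := by
  have hb' : Orthonormal ℂ (b ∘ ULift.down.{u}) := hb.comp _ ULift.down_injective
  refine ⟨hb'.orthogonalFamily.linearIsometry, fun k => ?_⟩
  rw [basisVec, hb'.orthogonalFamily.linearIsometry_apply_single]
  simp

/-! ### A unit vector with prescribed small coordinates -/

theorem sin_pi_div_two_pow_sq_le (k : ℕ) :
    ‖(Real.sin (Real.pi / 2 ^ (k + 3)) : ℂ)‖ ^ 2 ≤ 1 / 2 * (1 / 2) ^ k := by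
  have h0 : 0 ≤ Real.pi / 2 ^ (k + 3) := by positivity
  have h1 : Real.pi / 2 ^ (k + 3) ≤ (1 / 2) ^ (k + 1) := by
    rw [div_le_iff₀ (by positivity)]
    have : (1 / 2 : ℝ) ^ (k + 1) * 2 ^ (k + 3) = 4 := by
      rw [show k + 3 = (k + 1) + 2 by ring, pow_add 2, ← mul_assoc, ← mul_pow]; norm_num
    rw [this]; exact Real.pi_le_four
  rw [Complex.norm_real, Real.norm_eq_abs, sq_abs]
  have h2 := Real.abs_sin_le_abs (x := Real.pi / 2 ^ (k + 3))
  rw [abs_of_nonneg h0] at h2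
  have h3 : (1 / 2 : ℝ) ^ (k + 1) ≤ 1 := pow_le_one₀ (by norm_num) (by norm_num)
  have h4 : (0 : ℝ) < (1 / 2) ^ (k + 1) := by positivity
  calc Real.sin (Real.pi / 2 ^ (k + 3)) ^ 2
      = |Real.sin (Real.pi / 2 ^ (k + 3))| ^ 2 := (sq_abs _).symm
    _ ≤ ((1 / 2) ^ (k + 1)) ^ 2 := by gcongr; exact h2.trans h1
    _ ≤ (1 / 2) ^ (k + 1) := by nlinarith
    _ = 1 / 2 * (1 / 2) ^ k := by ring

/-- The squares of the prescribed coordinates are dominated by a geometric series of sum 1; the free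
coordinate 0 makes up the missing norm. -/
theorem exists_unit_vector : ∃ x : EllTwo.{u}, ‖x‖ = 1 ∧
    ∀ k, 1 ≤ k → x (ULift.up k) = (Real.sin (Real.pi / 2 ^ (k + 3)) : ℂ) := by
  let a : ULift.{u} ℕ → ℂ := fun k =>
    if k.down = 0 then 0 else (Real.sin (Real.pi / 2 ^ (k.down + 3)) : ℂ)
  have hle : ∀ k : ULift.{u} ℕ, ‖a k‖ ^ (2 : ENNReal).toReal ≤ 1 / 2 * (1 / 2) ^ k.down := by
    intro k
    simp only [ENNReal.toReal_ofNat, Real.rpow_ofNat]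
    by_cases h : k.down = 0
    · simp [a, h]
    · simp only [a, if_neg h]
      exact sin_pi_div_two_pow_sq_le k.down
  have hgeo : HasSum (fun k : ULift.{u} ℕ => (1 / 2 : ℝ) * (1 / 2) ^ k.down) 1 := by
    have := (hasSum_geometric_two.mul_left (1 / 2 : ℝ))
    norm_num at this
    exact (Equiv.ulift.{u}.hasSum_iff (f := fun k : ℕ => (1 / 2 : ℝ) * (1 / 2) ^ k)).2
      (by simpa using this)
  have hsum : Summable fun k => ‖a k‖ ^ (2 : ENNReal).toReal :=
    hgeo.summable.of_nonneg_of_le (fun _ => by positivity) hle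
  let w : EllTwo.{u} := ⟨a, memℓp_gen hsum⟩
  have hw : ‖w‖ ≤ 1 := by
    refine lp.norm_le_of_tsum_le (by norm_num) zero_le_one ?_
    rw [Real.one_rpow, ← hgeo.tsum_eq]
    exact hsum.tsum_le_tsum hle hgeo.summable
  have h0 : inner ℂ (basisVec 0) w = 0 := by
    rw [inner_basisVec_left]
    rfl
  refine ⟨(Real.sqrt (1 - ‖w‖ ^ 2) : ℂ) • basisVec 0 + w, ?_, fun k hk => ?_⟩
  · have h1 : 0 ≤ 1 - ‖w‖ ^ 2 := by nlinarith [norm_nonneg w]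
    have := norm_add_sq_eq_norm_sq_add_norm_sq_of_inner_eq_zero
      ((Real.sqrt (1 - ‖w‖ ^ 2) : ℂ) • basisVec 0) w
      (by rw [inner_smul_left, h0, mul_zero])
    rw [norm_smul, orthonormal_basisVec.1, Complex.norm_real, Real.norm_eq_abs,
      abs_of_nonneg (Real.sqrt_nonneg _), mul_one, Real.mul_self_sqrt h1] at this
    nlinarith [norm_nonneg ((Real.sqrt (1 - ‖w‖ ^ 2) : ℂ) • basisVec 0 + w)]
  · have hk0 : k ≠ 0 := by omega
    have hw : (w : ∀ _ : ULift.{u} ℕ, ℂ) (ULift.up k)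
        = (Real.sin (Real.pi / 2 ^ (k + 3)) : ℂ) := if_neg hk0
    rw [lp.coeFn_add, Pi.add_apply, lp.coeFn_smul, Pi.smul_apply, basisVec_apply, hw]
    simp [hk0]

end EllTwo

/-! ### Products of two reflections -/

/-- If `R` satisfies `R² v = 2 cos θ R v - v`, then its powers act on `v` as powers of a rotation
by the angle `θ`. -/
theorem sin_smul_iterate_apply {E : Type*} [AddCommGroup E] [Module ℂ E] (R : E →ₗ[ℂ] E)
    (x : E) (θ : ℝ) (h : R (R x) = (2 * Real.cos θ : ℂ) • R x - x) (k : ℕ) :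
    (Real.sin θ : ℂ) • (R ^ k) x
      = (Real.sin (k * θ) : ℂ) • R x - (Real.sin (k * θ - θ) : ℂ) • x := by
  induction k with
  | zero => simp
  | succ k ih =>
    have h2 : 2 * Real.cos θ * Real.sin (k * θ) - Real.sin (k * θ - θ)
        = Real.sin ((k + 1 : ℕ) * θ) := by
      push_cast
      rw [add_mul, one_mul, Real.sin_add, Real.sin_sub]; ring
    rw [pow_succ', Module.End.mul_apply, ← map_smul, ih, map_sub, map_smul, map_smul, h, ← h2,
      show ((k + 1 : ℕ) : ℝ) * θ - θ = k * θ by push_cast; ring]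
    push_cast
    module

theorem iterate_apply_eq_neg {E : Type*} [AddCommGroup E] [Module ℂ E] (R : E →ₗ[ℂ] E)
    (x : E) (k : ℕ) (hk : 2 ≤ k)
    (h : R (R x) = (2 * Real.cos (Real.pi / k) : ℂ) • R x - x) : (R ^ k) x = -x := by
  -- Since `2 ≤ k`, the angle `π / k` lies strictly between `0` and `π`, so its sine can be
  -- cancelled.
  have hk' : (0 : ℝ) < k := by positivity
  have hs : 0 < Real.sin (Real.pi / k) := by
    refine Real.sin_pos_of_pos_of_lt_pi (by positivity) ?_
    rw [div_lt_iff₀ hk']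
    have : (2 : ℝ) ≤ k := by exact_mod_cast hk
    nlinarith [Real.pi_pos]
  have := sin_smul_iterate_apply R x (Real.pi / k) h k
  rw [mul_div_cancel₀ _ hk'.ne', Real.sin_pi, Real.sin_pi_sub] at this
  have hs' : (Real.sin (Real.pi / k) : ℂ) ≠ 0 := by exact_mod_cast hs.ne'
  refine smul_right_injective E hs' ?_
  simpa using this

/-- Reflecting first in the line of the unit vector `x`, and then in the orthogonal complement of
the unit vector `y`, and iterating, one arrives at `-x`, if the angle is suitable. -/
theorem reflection_comp_reflection_pow_apply {E : Type*} [NormedAddCommGroup E]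
    [InnerProductSpace ℂ E] {x y : E} (hx : ‖x‖ = 1) (hy : ‖y‖ = 1) (k : ℕ) (hk : 2 ≤ k)
    (hxy : inner ℂ y x = (Real.sin (Real.pi / k / 2) : ℂ)) :
    (((ℂ ∙ y)ᗮ.reflection.toLinearIsometry.comp
      (ℂ ∙ x).reflection.toLinearIsometry).toLinearMap ^ k) x = -x := by
  have hy' : ∀ z : E, (ℂ ∙ y)ᗮ.reflection z = z - (2 * inner ℂ y z : ℂ) • y := by
    intro z
    rw [Submodule.reflection_orthogonal_apply, Submodule.reflection_singleton_apply, hy]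
    simp only [RCLike.ofReal_one, one_pow, div_one]
    module
  have hx' : ∀ z : E, (ℂ ∙ x).reflection z = (2 * inner ℂ x z : ℂ) • x - z := by
    intro z
    rw [Submodule.reflection_singleton_apply, hx]
    simp only [RCLike.ofReal_one, one_pow, div_one]
    module
  have hxx : inner ℂ x x = (1 : ℂ) := by rw [inner_self_eq_norm_sq_to_K, hx]; simp
  have hyx : inner ℂ x y = (Real.sin (Real.pi / k / 2) : ℂ) := by
    rw [← inner_conj_symm, hxy, Complex.conj_ofReal]
  have hyy : inner ℂ y y = (1 : ℂ) := by rw [inner_self_eq_norm_sq_to_K, hy]; simp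
  have hcos : Real.cos (Real.pi / k) = 1 - 2 * Real.sin (Real.pi / k / 2) ^ 2 := by
    rw [← Real.cos_two_mul_eq_one_sub]
    ring_nf
  -- The line of `x` meets the hyperplane orthogonal to `y` at angle `π / k / 2`; composing the
  -- reflections doubles this to `π / k`.
  refine iterate_apply_eq_neg _ x k hk ?_
  have h1 : ∀ z, ((ℂ ∙ y)ᗮ.reflection.toLinearIsometry.comp
      (ℂ ∙ x).reflection.toLinearIsometry).toLinearMap z
      = (ℂ ∙ y)ᗮ.reflection ((ℂ ∙ x).reflection z) := fun _ => rfl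
  simp only [h1, hx', hy', inner_sub_right, inner_smul_right, hxx, hyx, hxy, hyy, hcos]
  push_cast
  module

/-! ### An increasing sequence of subspaces of `ℓ²` -/

namespace HilbR

/-- The space `ℓ²` as a Hilbert space. -/
noncomputable def ellTwo : HilbR.{u} := ⟨EllTwo.{u}⟩

/-- A complete subspace of `ℓ²` as a Hilbert space. -/
noncomputable def ofSubmodule (S : Submodule ℂ EllTwo.{u}) [CompleteSpace S] : HilbR.{u} := ⟨S⟩

/-- The inclusion of a complete subspace of `ℓ²`. -/
noncomputable def incl (S : Submodule ℂ EllTwo.{u}) [CompleteSpace S] :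
    ofSubmodule S ⟶ ellTwo :=
  S.subtypeₗᵢ

/-- The increasing sequence of the spans of the first standard basis vectors of `ℓ²`. -/
noncomputable def initialSpans : ULift.{u} ℕ ⥤ HilbR.{u} where
  obj n := ofSubmodule (EllTwo.initialSpan n.down)
  map {m n} h :=
    ({ toLinearMap := Submodule.inclusion (EllTwo.initialSpan_mono (show m ≤ n from leOfHom h))
       norm_map' := fun _ => rfl } :
      EllTwo.initialSpan.{u} m.down →ₗᵢ[ℂ] EllTwo.initialSpan.{u} n.down)
  map_id _ := rfl
  map_comp _ _ := rfl

/-- The cocone which exhibits `ℓ²` as the completed union of `initialSpans`. -/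
noncomputable def initialSpansCocone : Cocone initialSpans.{u} where
  pt := ellTwo
  ι :=
    { app := fun n => incl (EllTwo.initialSpan n.down)
      naturality := fun _ _ _ => rfl }

/-- The cocone sends the basis vectors to an orthonormal sequence, which determines an isometry from
`ℓ²` because the target is complete. -/
theorem exists_desc (s : Cocone initialSpans.{u}) :
    ∃ f : ellTwo ⟶ s.pt, ∀ n, initialSpansCocone.ι.app n ≫ f = s.ι.app n := by
  let b : ∀ n : ℕ, ∀ k : ℕ, k ≤ n → EllTwo.initialSpan.{u} n := fun n k h =>
    ⟨EllTwo.basisVec k, EllTwo.basisVec_mem_initialSpan h⟩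
  let g : ∀ n : ℕ, EllTwo.initialSpan.{u} n →ₗᵢ[ℂ] s.pt.carrier := fun n => s.ι.app ⟨n⟩
  have hg : ∀ m n (h : m ≤ n) (x : EllTwo.initialSpan.{u} m),
      g n (Submodule.inclusion (EllTwo.initialSpan_mono h) x) = g m x := fun m n h x =>
    congrArg (fun f : EllTwo.initialSpan.{u} m →ₗᵢ[ℂ] s.pt.carrier => f x)
      (s.w (homOfLE h : (⟨m⟩ : ULift.{u} ℕ) ⟶ ⟨n⟩))
  have hb : ∀ n k (h : k ≤ n), g n (b n k h) = g k (b k k le_rfl) := fun n k h =>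
    hg k n h (b k k le_rfl)
  have horth : Orthonormal ℂ fun k => g k (b k k le_rfl) := by
    rw [orthonormal_iff_ite]
    intro i j
    -- Both vectors are moved into one common stage, where a single isometry preserves their inner
    -- product.
    rw [← hb (max i j) i (le_max_left _ _), ← hb (max i j) j (le_max_right _ _),
      (g _).inner_map_map]
    exact orthonormal_iff_ite.1 EllTwo.orthonormal_basisVec i j
  obtain ⟨f, hf⟩ := EllTwo.exists_linearIsometry.{u} horth
  refine ⟨f, fun n => ?_⟩
  have key : ∀ x (hx : x ∈ EllTwo.initialSpan.{u} n.down), f x = g n.down ⟨x, hx⟩ := by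
    intro x hx
    induction hx using Submodule.span_induction with
    | mem x hx =>
      obtain ⟨k, hk, rfl⟩ := hx
      rw [hf]
      exact (hb n.down k hk).symm
    | zero => rw [map_zero]; exact (map_zero (g n.down)).symm
    | add x y hx hy h1 h2 => rw [map_add, h1, h2]; exact (map_add (g n.down) _ _).symm
    | smul a x hx h1 => rw [map_smul, h1]; exact (map_smul (g n.down) _ _).symm
  exact LinearIsometry.ext fun x => key x.1 x.2

theorem hom_ellTwo_ext {X : HilbR.{u}} {f g : ellTwo ⟶ X}
    (h : ∀ n, initialSpansCocone.ι.app n ≫ f = initialSpansCocone.ι.app n ≫ g) : f = g :=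
  EllTwo.linearIsometry_ext fun k =>
    congrArg (fun t : EllTwo.initialSpan.{u} k →ₗᵢ[ℂ] X.carrier =>
      t ⟨EllTwo.basisVec k, EllTwo.basisVec_mem_initialSpan le_rfl⟩) (h ⟨k⟩)

/-- `ℓ²` is the colimit of `initialSpans`. -/
noncomputable def isColimitInitialSpansCocone : IsColimit initialSpansCocone.{u} where
  desc s := (exists_desc s).choose
  fac s := (exists_desc s).choose_spec
  uniq s _ hm := hom_ellTwo_ext fun n => (hm n).trans ((exists_desc s).choose_spec n).symm

/-! ### Faithful functors to sets miss the colimit -/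

/-- The isometry `x ↦ -x`. -/
noncomputable def neg (X : HilbR.{u}) : X ⟶ X :=
  (LinearIsometryEquiv.neg ℂ : X.carrier ≃ₗᵢ[ℂ] X.carrier).toLinearIsometry

theorem neg_ne_id {X : HilbR.{u}} (x : X.carrier) (hx : x ≠ 0) : neg X ≠ 𝟙 X := by
  intro h
  have h1 : -x = x := congrArg (fun t : X.carrier →ₗᵢ[ℂ] X.carrier => t x) h
  have h2 : (2 : ℂ) • x = 0 := by
    rw [two_smul]
    nth_rewrite 1 [← h1]
    exact neg_add_cancel x
  exact hx ((smul_eq_zero.1 h2).resolve_left two_ne_zero)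

theorem map_map_apply {C : Type*} [Category* C] (U : C ⥤ Type u) {X Y Z : C} {f : X ⟶ Y}
    {g : Y ⟶ Z} {h : X ⟶ Z} (e : f ≫ g = h) (x : U.obj X) : U.map g (U.map f x) = U.map h x := by
  rw [← e, U.map_comp, types_comp_apply]

theorem map_pow_eq {X : HilbR.{u}} (U : HilbR.{u} ⥤ Type u) (R : X.carrier →ₗᵢ[ℂ] X.carrier)
    (x : U.obj X) (h : U.map (X := X) (Y := X) R x = x) (k : ℕ) :
    U.map (X := X) (Y := X) (R ^ k : X.carrier →ₗᵢ[ℂ] X.carrier) x = x := by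
  induction k with
  | zero => exact congrArg (fun f => f x) (U.map_id X)
  | succ k ih =>
    refine (map_map_apply (X := X) (Y := X) (Z := X) U (f := R)
      (g := (R ^ k : X.carrier →ₗᵢ[ℂ] X.carrier)) rfl x).symm.trans ?_
    rw [h, ih]

/-- If a functor to sets is faithful on Hilbert spaces, then not all the elements of its value at
`ℓ²` come from the spans of the first basis vectors. -/
theorem exists_forall_map_ne (U : HilbR.{u} ⥤ Type u) [U.Faithful] :
    ∃ x : U.obj initialSpansCocone.{u}.pt, ∀ n y, U.map (initialSpansCocone.ι.app n) y ≠ x := by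
  by_contra! hsurj
  obtain ⟨v, hv, hvk⟩ := EllTwo.exists_unit_vector.{u}
  have hv0 : v ≠ 0 := by
    rintro rfl
    simp at hv
  let f : ofSubmodule (ℂ ∙ v) ⟶ ellTwo := incl (ℂ ∙ v)
  let A : HilbR.{u} := ofSubmodule (ℂ ∙ v)
  have hne : f ≠ neg A ≫ f := by
    intro h
    refine neg_ne_id (X := A)
      (⟨v, Submodule.mem_span_singleton_self v⟩ : (ℂ ∙ v : Submodule ℂ EllTwo.{u}))
      (fun h => hv0 (congrArg Subtype.val h)) (LinearIsometry.ext fun z => Subtype.ext ?_)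
    exact (congrArg (fun t : (ℂ ∙ v : Submodule ℂ EllTwo.{u}) →ₗᵢ[ℂ] EllTwo.{u} => t z) h).symm
  refine hne (U.map_injective ?_)
  refine ConcreteCategory.hom_ext _ _ fun x => ?_
  obtain ⟨⟨n⟩, y, hy⟩ := hsurj (U.map f x)
  -- The first basis vector outside the span that supports `U.map f x`.
  let w : EllTwo.{u} := EllTwo.basisVec (n + 1)
  let ρ₀ : EllTwo.{u} →ₗᵢ[ℂ] EllTwo.{u} := (ℂ ∙ w)ᗮ.reflection.toLinearIsometry
  let σ₀ : EllTwo.{u} →ₗᵢ[ℂ] EllTwo.{u} := (ℂ ∙ v).reflection.toLinearIsometry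
  let ρ : ellTwo.{u} ⟶ ellTwo := ρ₀
  let σ : ellTwo.{u} ⟶ ellTwo := σ₀
  let R : EllTwo.{u} →ₗᵢ[ℂ] EllTwo.{u} := ρ₀.comp σ₀
  have hσ₀ : ∀ z ∈ ℂ ∙ v, σ₀ z = z := fun z hz => Submodule.reflection_mem_subspace_eq_self hz
  have hσ : f ≫ σ = f := LinearIsometry.ext fun z => hσ₀ z.1 z.2
  have hle : EllTwo.initialSpan.{u} n ≤ (ℂ ∙ w)ᗮ := by
    refine Submodule.span_le.2 ?_
    rintro _ ⟨k, hk, rfl⟩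
    refine Submodule.mem_orthogonal_singleton_iff_inner_right.2 ?_
    refine EllTwo.orthonormal_basisVec.2 ?_
    have : k ≤ n := hk
    omega
  have hρ₀ : ∀ z ∈ EllTwo.initialSpan.{u} n, ρ₀ z = z := fun z hz =>
    Submodule.reflection_mem_subspace_eq_self (hle hz)
  have hρ : initialSpansCocone.ι.app ⟨n⟩ ≫ ρ = initialSpansCocone.ι.app ⟨n⟩ :=
    LinearIsometry.ext fun z => hρ₀ z.1 z.2
  -- `σ` fixes the element because it comes from the line, `ρ` because it comes from the span.
  have hR : U.map (X := ellTwo) (Y := ellTwo) R (U.map f x) = U.map f x := by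
    refine (map_map_apply (f := σ) (g := ρ) U rfl _).symm.trans ?_
    rw [map_map_apply U hσ]
    exact (congrArg (U.map ρ) hy.symm).trans ((map_map_apply U hρ y).trans hy)
  -- Coordinate `n + 1` of `v` is the sine of `π / 2 ^ (n + 4)`, half of `π / 2 ^ (n + 3)`.
  have hpow : (R.toLinearMap ^ 2 ^ (n + 3)) v = -v := by
    refine reflection_comp_reflection_pow_apply hv (EllTwo.orthonormal_basisVec.1 _) _ ?_ ?_
    · rw [pow_succ]
      have := Nat.one_le_two_pow (n := n + 2)
      omega
    · rw [EllTwo.inner_basisVec_left, hvk _ (by omega)]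
      congr 2
      push_cast
      rw [div_div, ← pow_succ]
  let S : ellTwo.{u} ⟶ ellTwo := (R ^ 2 ^ (n + 3) : EllTwo.{u} →ₗᵢ[ℂ] EllTwo.{u})
  have hcomp : f ≫ S = neg A ≫ f := by
    refine LinearIsometry.ext fun z => ?_
    obtain ⟨z, hz⟩ := z
    obtain ⟨a, rfl⟩ := Submodule.mem_span_singleton.1 hz
    change (R ^ 2 ^ (n + 3)) (a • v) = -(a • v)
    rw [map_smul, ← smul_neg, ← hpow, LinearIsometry.coe_pow, Module.End.coe_pow]
    rfl
  exact (map_pow_eq U R _ hR _).symm.trans (map_map_apply U hcomp x)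

end HilbR

/-! ### Directed colimits of models of a first-order theory -/

namespace ModelCat

open Filter

variable {L : FirstOrder.Language.{u, u}} {T : L.Theory}

/-- The ultraproduct of a family of nonempty models. -/
def ultraproduct {J : Type u} (𝒰 : Ultrafilter J) (M : J → ModelCat T)
    [∀ j, Nonempty (M j).carrier] : ModelCat T where
  carrier := (𝒰 : Filter J).Product fun j => (M j).carrier
  -- Łoś's theorem.
  models := ⟨fun φ hφ => Language.Ultraproduct.sentence_realize φ |>.2
    (Eventually.of_forall fun j => (M j).models.realize_of_mem φ hφ)⟩

variable {J : Type u} {𝒰 : Ultrafilter J} {M : J → ModelCat T}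

theorem relMap_ultraproduct {n : ℕ} (r : L.Relations n) (x : Fin n → ∀ j, (M j).carrier) :
    Language.Structure.RelMap r
      (fun i => (x i : (𝒰 : Filter J).Product fun j => (M j).carrier)) ↔
      ∀ᶠ j in 𝒰, Language.Structure.RelMap r fun i => x i j :=
  Language.relMap_quotient_mk' (s := (𝒰 : Filter J).productSetoid fun j => (M j).carrier)
    (ps := Language.Ultraproduct.setoidPrestructure _ 𝒰) r x

variable [∀ j, Nonempty (M j).carrier]

/-- A family of homomorphisms to the factors, defined from some index on, gives a homomorphism to
the ultraproduct. -/
def toUltraproduct (X : ModelCat T) (s : Set J) (hs : s ∈ 𝒰) (f : ∀ j, X.carrier → (M j).carrier)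
    (g : ∀ j, j ∈ s → (X ⟶ M j)) (hfg : ∀ j hj x, f j x = (g j hj).toFun x) :
    X ⟶ ultraproduct 𝒰 M where
  toFun x := ((fun j => f j x : ∀ j, (M j).carrier) :
    (𝒰 : Filter J).Product fun j => (M j).carrier)
  map_fun' F x := by
    refine Eq.trans ?_ (Language.Ultraproduct.funMap_cast F (fun i j => f j (x i))).symm
    refine Quotient.sound ?_
    refine mem_of_superset hs fun j hj => ?_
    simp only [Set.mem_ofPred_eq, hfg j hj]
    exact (g j hj).map_fun' F x
  map_rel' r x hx := by
    refine (relMap_ultraproduct r fun i j => f j (x i)).2 ?_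
    refine mem_of_superset hs fun j hj => ?_
    simp only [Set.mem_ofPred_eq, hfg j hj]
    exact (g j hj).map_rel' r x hx

/-- The homomorphism of ultraproducts induced by homomorphisms of the factors. -/
def mapUltraproduct {N : J → ModelCat T} [∀ j, Nonempty (N j).carrier] (g : ∀ j, M j ⟶ N j) :
    ultraproduct 𝒰 M ⟶ ultraproduct 𝒰 N where
  toFun := Quotient.map (fun x j => (g j).toFun (x j)) fun x y h =>
    mem_of_superset h fun j (hj : x j = y j) => congrArg (g j).toFun hj
  map_fun' F x := by
    obtain ⟨x, rfl⟩ : ∃ y : Fin _ → ∀ j, (M j).carrier,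
        x = fun i => (y i : (𝒰 : Filter J).Product fun j => (M j).carrier) :=
      ⟨fun i => (x i).out, funext fun i => (Quotient.out_eq _).symm⟩
    refine (congrArg _ (Language.Ultraproduct.funMap_cast F x)).trans
      (Eq.trans ?_ (Language.Ultraproduct.funMap_cast F (fun i j => (g j).toFun (x i j))).symm)
    refine congrArg (Quotient.mk _) ?_
    funext j
    exact (g j).map_fun' F fun i => x i j
  map_rel' r x hx := by
    obtain ⟨x, rfl⟩ : ∃ y : Fin _ → ∀ j, (M j).carrier,
        x = fun i => (y i : (𝒰 : Filter J).Product fun j => (M j).carrier) :=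
      ⟨fun i => (x i).out, funext fun i => (Quotient.out_eq _).symm⟩
    refine (relMap_ultraproduct r fun i j => (g j).toFun (x i j)).2 ?_
    exact mem_of_superset ((relMap_ultraproduct r x).1 hx) fun j hj => (g j).map_rel' r _ hj

/-- The forgetful functor from the models of a theory to sets. -/
def forget (T : L.Theory) : ModelCat T ⥤ Type u where
  obj M := M.carrier
  map f := TypeCat.ofHom f.toFun

instance (T : L.Theory) : (forget T).Faithful where
  map_injective {M N f g} h := by
    refine Language.Hom.ext fun x => ?_
    exact congrArg (fun t : (forget T).obj M ⟶ (forget T).obj N => t x) h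

/-- The colimit of a directed diagram of nonempty models, if it exists in the category of models,
is the union of the images of the models in the diagram. -/
theorem jointly_surjective_of_isColimit {J : Type u} [PartialOrder J] [IsDirectedOrder J]
    [Nonempty J] (F : J ⥤ ModelCat T) [∀ j, Nonempty (F.obj j).carrier] {c : Cocone F}
    (hc : IsColimit c) (x : c.pt.carrier) : ∃ j y, (c.ι.app j).toFun y = x := by
  classical
  -- All tails belong to `𝒰`, so the transition maps out of stage `j` need only be defined on
  -- indices above `j`; the default value elsewhere is invisible.
  let 𝒰 : Ultrafilter J := Ultrafilter.of atTop
  have hmem : ∀ j : J, Set.Ici j ∈ 𝒰 := fun j => Ultrafilter.of_le atTop (mem_atTop j)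
  have : Nonempty c.pt.carrier :=
    ‹Nonempty J›.elim fun j => (inferInstance : Nonempty (F.obj j).carrier).map (c.ι.app j).toFun
  have : ∀ j : J, Nonempty ((fun _ : J => c.pt) j).carrier := fun _ => this
  let s : Cocone F :=
    { pt := ultraproduct 𝒰 F.obj
      ι :=
        { app := fun j => toUltraproduct (F.obj j) (Set.Ici j) (hmem j)
            (fun k y => if h : j ≤ k then (F.map (homOfLE h)).toFun y else Classical.ofNonempty)
            (fun k h => F.map (homOfLE h)) (fun k h y => dif_pos h)
          naturality := by
            intro i j hij
            refine Language.Hom.ext fun y => ?_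
            refine Quotient.sound (mem_of_superset (hmem j) fun k (hk : j ≤ k) => ?_)
            change dite _ _ _ = dite _ _ _
            rw [dif_pos hk, dif_pos ((leOfHom hij).trans hk)]
            exact congrArg (fun t : F.obj i ⟶ F.obj k => t.toFun y)
              (F.map_comp hij (homOfLE hk)).symm } }
  let δ : c.pt ⟶ ultraproduct 𝒰 fun _ => c.pt :=
    toUltraproduct c.pt Set.univ univ_mem (fun _ y => y) (fun _ _ => 𝟙 _) fun _ _ _ => rfl
  let μ : s.pt ⟶ ultraproduct 𝒰 fun _ => c.pt :=
    mapUltraproduct (M := F.obj) (N := fun _ => c.pt) fun j => c.ι.app j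
  -- The diagonal of the colimit factors through the ultraproduct of the stages. Hence `x` equals,
  -- at almost every index, the image of an element of that stage.
  have hδ : hc.desc s ≫ μ = δ := by
    refine hc.hom_ext fun j => ?_
    rw [← Category.assoc, hc.fac]
    refine Language.Hom.ext fun y => ?_
    refine Quotient.sound (mem_of_superset (hmem j) fun k (hk : j ≤ k) => ?_)
    change (c.ι.app k).toFun (dite _ _ _) = (c.ι.app j).toFun y
    rw [dif_pos hk, ← c.w (homOfLE hk)]
    rfl
  obtain ⟨z, hz⟩ := Quotient.exists_rep ((hc.desc s).toFun x)
  have hx : μ.toFun ((hc.desc s).toFun x) = δ.toFun x :=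
    congrArg (fun t : c.pt.carrier →[L] (ultraproduct 𝒰 fun _ => c.pt).carrier => t x) hδ
  rw [← hz] at hx
  have hev : ∀ᶠ j in (𝒰 : Filter J), (c.ι.app j).toFun (z j) = x := Quotient.exact hx
  obtain ⟨j, hj⟩ := hev.exists
  exact ⟨j, z j, hj⟩

end ModelCat

/-! ### Colimits of chains in an abstract elementary class -/

namespace AbstractElementaryClass

variable {L : FirstOrder.Language.{u, u}} (K : AbstractElementaryClass L)

/-- The forgetful functor from an abstract elementary class to sets. -/
def forget : K.Obj ⥤ Type u where
  obj M := M.carrier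
  map f := TypeCat.ofHom f.1

instance : K.forget.Faithful where
  map_injective {M N f g} h := by
    refine Subtype.ext (Language.Embedding.ext fun x => ?_)
    exact congrArg (fun t : K.forget.obj M ⟶ K.forget.obj N => t x) h

variable {K}

/-- This is coherence in terms of embeddings; it makes the union of a chain of images the vertex of
a cocone. -/
theorem isStrongEmbedding_codRestrict {M N : Type u} [L.Structure M] [L.Structure N]
    {f : M ↪[L] N} (hf : K.IsStrongEmbedding f) {S : L.Substructure N} (hS : K.Strong S)
    (h : ∀ x, f x ∈ S) : K.IsStrongEmbedding (f.codRestrict S h) := by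
  have hle : f.toHom.range ≤ S := by
    rintro _ ⟨x, rfl⟩
    exact h x
  have : (f.codRestrict S h).toHom.range = f.toHom.range.within S := by
    ext ⟨y, hy⟩
    constructor
    · rintro ⟨x, hx⟩
      exact ⟨x, congrArg Subtype.val hx⟩
    · rintro ⟨x, hx⟩
      exact ⟨x, Subtype.ext hx⟩
  unfold IsStrongEmbedding
  rw [this]
  exact K.coherence hle hf hS

theorem isStrongEmbedding_subtype {N : Type u} [L.Structure N] {S : L.Substructure N}
    (hS : K.Strong S) : K.IsStrongEmbedding S.subtype := by
  unfold IsStrongEmbedding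
  have : S.subtype.toHom.range = S := by
    ext x
    simp
  rwa [this]

theorem comp_apply {M N P : K.Obj} (f : M ⟶ N) (g : N ⟶ P) (x : M.carrier) :
    (f ≫ g).1 x = g.1 (f.1 x) := rfl

/-- The colimit of a well-ordered chain, if it exists in an abstract elementary class, is the union
of the images of the members of the chain. -/
theorem jointly_surjective_of_isColimit {J : Type u} [LinearOrder J] [WellFoundedLT J]
    [Nonempty J] (F : J ⥤ K.Obj) {c : Cocone F} (hc : IsColimit c) (x : c.pt.carrier) :
    ∃ j y, (c.ι.app j).1 y = x := by
  let M : J → L.Substructure c.pt.carrier := fun j => (c.ι.app j).1.toHom.range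
  have hM : ∀ j, K.Strong (M j) := fun j => (c.ι.app j).2
  have hmono : Monotone M := by
    rintro i j hij _ ⟨y, rfl⟩
    refine ⟨(F.map (homOfLE hij)).1 y, ?_⟩
    have := c.w (homOfLE hij)
    rw [← this]
    rfl
  let S : L.Substructure c.pt.carrier := ⨆ j, M j
  have hS : K.Strong S := K.chain_smooth M hmono
    (fun i j hij => K.coherence (hmono hij) (hM i) (hM j)) hM
  have hmem : ∀ j y, (c.ι.app j).1 y ∈ S := fun j y => le_iSup M j ⟨y, rfl⟩
  let s : Cocone F :=
    { pt := ⟨S, (K.mem_of_strong hS).1⟩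
      ι :=
        { app := fun j => ⟨(c.ι.app j).1.codRestrict S (hmem j),
            isStrongEmbedding_codRestrict (c.ι.app j).2 hS (hmem j)⟩
          naturality := by
            intro i j hij
            refine Subtype.ext (Language.Embedding.ext fun y => Subtype.ext ?_)
            have := c.w hij
            change (c.ι.app j).1 ((F.map hij).1 y) = (c.ι.app i).1 y
            rw [← this]
            rfl } }
  let i : s.pt ⟶ c.pt := ⟨S.subtype, isStrongEmbedding_subtype hS⟩
  -- The inclusion of the union thus has a section, so the union is the whole colimit.
  have hi : hc.desc s ≫ i = 𝟙 c.pt := by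
    refine hc.hom_ext fun j => ?_
    rw [← Category.assoc, hc.fac, Category.comp_id]
    rfl
  have hx : i.1 ((hc.desc s).1 x) = x := by
    rw [← comp_apply, hi]
    rfl
  have hxS : x ∈ S := by
    rw [← hx]
    exact ((hc.desc s).1 x : S).2
  obtain ⟨j, y, hy⟩ := (Language.Substructure.mem_iSup_of_directed hmono.directed_le).1 hxS
  exact ⟨j, y, hy⟩

end AbstractElementaryClass

/-! ### The main theorem -/

namespace HilbR

theorem not_preservesDirectedColimits (U : HilbR.{u} ⥤ Type u) (hU : U.Faithful) :
    ¬ PreservesDirectedColimits.{u} U := by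
  intro h
  obtain ⟨x, hx⟩ := exists_forall_map_ne U
  have := h (ULift.{u} ℕ)
  obtain ⟨n, y, hy⟩ := Types.jointly_surjective_of_isColimit
    (isColimitOfPreserves U isColimitInitialSpansCocone) x
  exact hx n y hy

theorem not_isEquivalentToAEC : ¬ IsEquivalentToAEC HilbR.{u} := by
  rintro ⟨L, K, ⟨e⟩⟩
  obtain ⟨x, hx⟩ := exists_forall_map_ne (e.functor ⋙ K.forget)
  obtain ⟨n, y, hy⟩ := AbstractElementaryClass.jointly_surjective_of_isColimit
    (initialSpans ⋙ e.functor) (isColimitOfPreserves e.functor isColimitInitialSpansCocone) x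
  exact hx n y hy

theorem not_isElementaryCategory : ¬ IsElementaryCategory HilbR.{u} := by
  rintro ⟨L, T, ⟨e⟩⟩
  obtain ⟨x, hx⟩ := exists_forall_map_ne (e.functor ⋙ ModelCat.forget T)
  -- An empty model has only one endomorphism, whereas each span has the distinct endomorphisms
  -- `neg` and the identity.
  have hne : ∀ n, Nonempty ((initialSpans ⋙ e.functor).obj n).carrier := by
    intro n
    by_contra hempty
    rw [not_nonempty_iff] at hempty
    refine neg_ne_id (X := initialSpans.obj n) ?_ ?_ (e.functor.map_injective ?_)
    · exact (⟨EllTwo.basisVec 0, EllTwo.basisVec_mem_initialSpan (Nat.zero_le _)⟩ :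
        EllTwo.initialSpan.{u} n.down)
    · intro h
      exact EllTwo.orthonormal_basisVec.ne_zero 0 (congrArg Subtype.val h)
    · exact Language.Hom.ext fun y => hempty.elim y
  obtain ⟨n, y, hy⟩ := ModelCat.jointly_surjective_of_isColimit
    (initialSpans ⋙ e.functor) (isColimitOfPreserves e.functor isColimitInitialSpansCocone) x
  exact hx n y hy

end HilbR

theorem mainTheorem1 :
    (∀ U : HilbR.{u} ⥤ Type u, U.Faithful → ¬ PreservesDirectedColimits.{u} U) ∧
    ¬ FinitelyConcrete.{u} HilbR.{u} ∧
    ¬ IsEquivalentToAEC HilbR.{u} ∧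
    ¬ IsElementaryCategory HilbR.{u} :=
  ⟨HilbR.not_preservesDirectedColimits,
    fun ⟨U, hU, h⟩ => HilbR.not_preservesDirectedColimits U hU h,
    HilbR.not_isEquivalentToAEC, HilbR.not_isElementaryCategory⟩
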